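/- Let $X\neq\{0\}$ be a finite-dimensional real normed space. A flow on $X$ is a continuous map $\varphi:\mathbb R\times X\to X$, $(t,x)\mapsto\varphi_t(x)$, with $\varphi_0=\mathrm{id}_X$ and $\varphi_{t+s}=\varphi_t\circ\varphi_s$ for all $s,t\in\mathbb R$. A flow $\Phi$ is *stable* if every $\Phi_t$ is linear and $\lim_{t\to\infty}\Phi_t x=0$ for every $x\in X$. For a linear flow $\Phi$, $m\in\mathbb N_0$ and $s\in\mathbb R$ let $$L_m^{\Phi}(s)=\Bigl\{x\in X:\ \lim_{t\to\infty}\frac{\Phi_t x}{e^{st}\,t^m}=0\Bigr\}.$$ Let $\Phi,\Psi$ be stable flows on $X$, and let $h:X\to X$ be a homeomorphism with $h(0)=0$ such that $h$ and $h^{-1}$ are both Lipschitz on some ball centred at $0$. Assume that $h$ maps orbits onto orbits, i.e. $h(\{\Phi_t x:t\in\mathbb R\})=\{\Psi_t h(x):t\in\mathbb R\}$ for every $x\in X$. Then there is a unique $\alpha>0$ with $$h\bigl(L_m^{\Phi}(\alpha s)\bigr)=L_m^{\Psi}(s)\qquad\text{for all } m\in\mathbb N_0,\ s\in\mathbb R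 .$$ Moreover, for every $x\in X\setminus\{0\}$ there is exactly one continuous bijection $\tau_x:\mathbb R\to\mathbb R$ with $\tau_x(0)=0$ and $h(\Phi_t x)=\Psi_{\tau_x(t)}h(x)$ for all $t\in\mathbb R$, and with the same $\alpha$ it satisfies $$\sup_{t\ge 0}|\tau_x(t)-\alpha t|<\infty .$$ -/

import Mathlib

open Filter Topology

namespace LipFlow

/-- A linear flow: every time-`t` map is linear. -/
def IsLinear {X : Type*} [NormedAddCommGroup X] [NormedSpace ℝ X] (Φ : Flow ℝ X) : Prop :=
  ∀ t : ℝ, IsLinearMap ℝ (Φ t)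

/-- A stable flow: a linear flow whose stable space `{x | Φ t x → 0 as t → ∞}` is all of `X`. -/
structure IsStable {X : Type*} [NormedAddCommGroup X] [NormedSpace ℝ X] (Φ : Flow ℝ X) :
    Prop where
  linear : IsLinear Φ
  tendsto_zero : ∀ x : X, Tendsto (fun t : ℝ => Φ t x) atTop (𝓝 0)

/-- `Φ` is `h`-related to `Ψ`: the homeomorphism `h` maps each `Φ`-orbit onto a `Ψ`-orbit. -/
def IsRelated {X : Type*} [TopologicalSpace X] (Φ Ψ : Flow ℝ X) (h : X ≃ₜ X) : Prop :=
  ∀ x : X, h '' Φ.orbit x = Ψ.orbit (h x)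

/-- Homeomorphisms fixing `0` which, together with their inverse, are Lipschitz on some ball
around `0`. -/
def IsBiLipschitzNearZero {X : Type*} [NormedAddCommGroup X] (h : X ≃ₜ X) : Prop :=
  h 0 = 0 ∧ ∃ r : ℝ, 0 < r ∧ ∃ K : NNReal,
    LipschitzOnWith K h (Metric.ball 0 r) ∧ LipschitzOnWith K h.symm (Metric.ball 0 r)

/-- The refined Lyapunov space `L_m^Φ(s)`, i.e. the set of all `x` for which
`Φ t x / (exp (s t) * t ^ m)` tends to `0` as `t → ∞`. -/
def refinedLyapunov {X : Type*} [NormedAddCommGroup X] [NormedSpace ℝ X] (Φ : Flow ℝ X)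
    (m : ℕ) (s : ℝ) : Set X :=
  {x : X | Tendsto (fun t : ℝ => (Real.exp (s * t) * t ^ m)⁻¹ • Φ t x) atTop (𝓝 0)}

/-- `τ` is a time reparametrization at `x`: a continuous bijection of `ℝ` with `τ 0 = 0` and
`h (Φ t x) = Ψ (τ t) (h x)` for all `t`. -/
structure IsTimeReparam {X : Type*} [TopologicalSpace X] (Φ Ψ : Flow ℝ X) (h : X ≃ₜ X) (x : X)
    (τ : ℝ → ℝ) : Prop where
  continuous : Continuous τ
  bijective : Function.Bijective τ
  map_zero : τ 0 = 0
  map_orbit : ∀ t : ℝ, h (Φ t x) = Ψ (τ t) (h x)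

end LipFlow

namespace LipFlow

open MeasureTheory Module Set

/-! ### Linear and stable flows: contraction, properness, determinant. -/

section LinearFlow

variable {X : Type*} [NormedAddCommGroup X] [NormedSpace ℝ X]

/-! The clock comparison comes from volume. Since `log |det Φ_t|` is additive and continuous in `t`,
`|det Φ_t| = exp (-a t)` and `|det Ψ_t| = exp (-b t)`, with `a, b > 0` by stability. A bi-Lipschitz
map changes volume by at most a bounded factor, so `h` must match the two rates of volume loss.

Balls cannot be followed directly, because different points of a ball have different time changes.
Instead a small ball `S` about `x` is thickened along the flow: near `0` a fixed `Φ`-time `σ`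
corresponds to a `Ψ`-time between `1` and a constant (`exists_step_bounds`). So, up to finitely many
fixed time shifts, `h` carries the `Φ_t`-image of a `Φ`-tube over `S` to the `Ψ_T`-image of a
`Ψ`-tube over `h(S)`, where `T = τ_x(t)`. Comparing volumes at times `t` and `0` eliminates the size
of `S` and bounds `b τ_x(t) - a t` uniformly (`exists_volume_comparison`). Hence `α = a / b`.

A bounded time error changes norms along orbits only by a bounded factor, as does `h` near `0`; the
Lyapunov spaces therefore correspond. Uniqueness of `α` holds because the exponents `s` with `L_0(s)
= X` include a negative number but are bounded below, which no nontrivial rescaling permits. -/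

theorem flow_neg_flow {X : Type*} [TopologicalSpace X] (Φ : Flow ℝ X) (t : ℝ) (x : X) :
    Φ (-t) (Φ t x) = x := by
  rw [← Φ.map_add, neg_add_cancel, Φ.map_zero_apply]

theorem IsLinear.map_zero {Φ : Flow ℝ X} (hΦ : IsLinear Φ) (t : ℝ) : Φ t 0 = 0 :=
  (hΦ t).map_zero

theorem IsLinear.map_ne_zero {Φ : Flow ℝ X} (hΦ : IsLinear Φ) (t : ℝ) {x : X} (hx : x ≠ 0) :
    Φ t x ≠ 0 := fun h0 => hx <| by
  rw [← flow_neg_flow Φ t x, h0, hΦ.map_zero]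

variable [FiniteDimensional ℝ X]

/-- The time-`t` map of a linear flow as a continuous linear map. -/
noncomputable def IsLinear.clm {Φ : Flow ℝ X} (hΦ : IsLinear Φ) (t : ℝ) : X →L[ℝ] X :=
  LinearMap.toContinuousLinearMap (IsLinearMap.mk' (Φ t) (hΦ t))

@[simp] theorem IsLinear.clm_apply {Φ : Flow ℝ X} (hΦ : IsLinear Φ) (t : ℝ) (x : X) :
    hΦ.clm t x = Φ t x := rfl

theorem IsLinear.clm_add {Φ : Flow ℝ X} (hΦ : IsLinear Φ) (s t : ℝ) :
    hΦ.clm (s + t) = hΦ.clm s * hΦ.clm t := by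
  ext x
  simp [Φ.map_add]

theorem IsLinear.clm_zero {Φ : Flow ℝ X} (hΦ : IsLinear Φ) : hΦ.clm 0 = 1 := by
  ext x
  simp

theorem IsLinear.continuous_clm {Φ : Flow ℝ X} (hΦ : IsLinear Φ) : Continuous hΦ.clm :=
  continuous_clm_apply.2 fun x => by
    simp only [IsLinear.clm_apply]
    exact Φ.continuous continuous_id continuous_const

/-- A linear flow is uniformly bounded on bounded time intervals. -/
theorem IsLinear.exists_bound_Icc {Φ : Flow ℝ X} (hΦ : IsLinear Φ) (a b : ℝ) :
    ∃ C : ℝ, 0 < C ∧ ∀ t ∈ Icc a b, ∀ x, ‖Φ t x‖ ≤ C * ‖x‖ := by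
  obtain ⟨C, hC⟩ := (isCompact_Icc (a := a) (b := b)).exists_bound_of_continuousOn
    hΦ.continuous_clm.continuousOn
  refine ⟨max C 1, by positivity, fun t ht x => ?_⟩
  have h1 : ‖hΦ.clm t x‖ ≤ ‖hΦ.clm t‖ * ‖x‖ := (hΦ.clm t).le_opNorm x
  exact h1.trans (mul_le_mul_of_nonneg_right ((hC t ht).trans (le_max_left _ _)) (norm_nonneg _))

theorem IsStable.tendsto_clm {Φ : Flow ℝ X} (hΦ : IsStable Φ) :
    Tendsto hΦ.linear.clm atTop (𝓝 0) := by
  obtain ⟨C, hC0, hC⟩ := (finBasis ℝ X).exists_opNorm_le (F := X)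
  rw [Metric.tendsto_nhds]
  intro ε hε
  have h1 : ∀ᶠ t in atTop, ∀ i, ‖Φ t (finBasis ℝ X i)‖ < ε / (2 * C) := by
    rw [eventually_all]
    intro i
    have := (hΦ.tendsto_zero (finBasis ℝ X i)).norm
    rw [norm_zero] at this
    exact this.eventually_lt_const (by positivity)
  filter_upwards [h1] with t ht
  rw [dist_zero_right]
  have h2 := hC (u := hΦ.linear.clm t) (M := ε / (2 * C)) (by positivity) (fun i => (ht i).le)
  have h3 : C * (ε / (2 * C)) = ε / 2 := by field_simp
  linarith

/-- A stable flow is eventually a uniform contraction with arbitrarily small constant. -/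
theorem IsStable.exists_contraction {Φ : Flow ℝ X} (hΦ : IsStable Φ) {ε : ℝ} (hε : 0 < ε) :
    ∃ T : ℝ, 0 < T ∧ ∀ t, T ≤ t → ∀ x, ‖Φ t x‖ ≤ ε * ‖x‖ := by
  have h := hΦ.tendsto_clm.norm
  rw [norm_zero] at h
  obtain ⟨T, hT⟩ := eventually_atTop.1 (h.eventually_lt_const hε)
  refine ⟨max T 1, by positivity, fun t ht x => ?_⟩
  have h1 : ‖hΦ.linear.clm t x‖ ≤ ‖hΦ.linear.clm t‖ * ‖x‖ := (hΦ.linear.clm t).le_opNorm x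
  exact h1.trans (mul_le_mul_of_nonneg_right (hT t ((le_max_left _ _).trans ht)).le
    (norm_nonneg _))

/-- A stable flow is uniformly bounded in forward time. -/
theorem IsStable.exists_bound {Φ : Flow ℝ X} (hΦ : IsStable Φ) :
    ∃ C : ℝ, 0 < C ∧ ∀ t, 0 ≤ t → ∀ x, ‖Φ t x‖ ≤ C * ‖x‖ := by
  obtain ⟨T, -, hT⟩ := hΦ.exists_contraction one_pos
  obtain ⟨C, hC0, hC⟩ := hΦ.linear.exists_bound_Icc 0 T
  refine ⟨max C 1, by positivity, fun t ht x => ?_⟩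
  rcases le_total t T with h | h
  · exact (hC t ⟨ht, h⟩ x).trans (mul_le_mul_of_nonneg_right (le_max_left _ _) (norm_nonneg _))
  · exact (hT t h x).trans (mul_le_mul_of_nonneg_right (le_max_right _ _) (norm_nonneg _))

/-- If the flow does not shrink `z` by more than a given factor, the elapsed time is bounded. -/
theorem IsStable.exists_time_le {Φ : Flow ℝ X} (hΦ : IsStable Φ) {κ : ℝ} (hκ : 0 < κ) :
    ∃ R : ℝ, 0 < R ∧ ∀ t z, z ≠ 0 → κ * ‖z‖ ≤ ‖Φ t z‖ → t ≤ R := by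
  obtain ⟨T, hT0, hT⟩ := hΦ.exists_contraction (half_pos hκ)
  refine ⟨T, hT0, fun t z hz h => ?_⟩
  by_contra hlt
  have h1 := hT t (not_le.1 hlt).le z
  have h2 : 0 < ‖z‖ := norm_pos_iff.2 hz
  nlinarith

theorem IsStable.exists_abs_time_le {Φ : Flow ℝ X} (hΦ : IsStable Φ) {κ : ℝ} (hκ : 0 < κ) :
    ∃ R : ℝ, 0 < R ∧ ∀ t z, z ≠ 0 → κ * ‖z‖ ≤ ‖Φ t z‖ → κ * ‖Φ t z‖ ≤ ‖z‖ → |t| ≤ R := by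
  obtain ⟨R, hR0, hR⟩ := hΦ.exists_time_le hκ
  refine ⟨R, hR0, fun t z hz h1 h2 => abs_le.2 ⟨?_, hR t z hz h1⟩⟩
  have := hR (-t) (Φ t z) (hΦ.linear.map_ne_zero t hz) (by rwa [flow_neg_flow])
  linarith

theorem IsStable.flow_injective {Φ : Flow ℝ X} (hΦ : IsStable Φ) {x : X} (hx : x ≠ 0) :
    Function.Injective fun t => Φ t x := by
  have key : ∀ s t : ℝ, s < t → Φ s x ≠ Φ t x := by
    intro s t hst he
    set y := Φ s x with hy
    have hy0 : y ≠ 0 := hΦ.linear.map_ne_zero s hx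
    have h1 : Φ (t - s) y = y := by
      rw [hy, ← Φ.map_add, sub_add_cancel, ← he]
    have h2 : ∀ n : ℕ, Φ (n * (t - s)) y = y := by
      intro n
      induction n with
      | zero => simp
      | succ n ih =>
        rw [Nat.cast_succ, add_mul, one_mul, Φ.map_add, h1, ih]
    -- A periodic orbit never shrinks, yet it would return to `y` after arbitrarily long times.
    obtain ⟨R, -, hR⟩ := hΦ.exists_time_le one_pos
    obtain ⟨n, hn⟩ := exists_nat_gt (R / (t - s))
    have h3 := hR (n * (t - s)) y hy0 (by rw [h2, one_mul])
    rw [div_lt_iff₀ (by linarith)] at hn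
    linarith
  intro s t he
  rcases lt_trichotomy s t with h | h | h
  · exact (key s t h he).elim
  · exact h
  · exact (key t s h he.symm).elim

/-- The action of a stable flow on the nonzero vectors is proper: times depend continuously on
source and target. -/
theorem IsStable.tendsto_time {Φ : Flow ℝ X} (hΦ : IsStable Φ) {ι : Type*} {l : Filter ι}
    {z : ι → X} {u : ι → ℝ} {z₀ : X} {u₀ : ℝ} (hz₀ : z₀ ≠ 0) (hz : Tendsto z l (𝓝 z₀))
    (hu : Tendsto (fun i => Φ (u i) (z i)) l (𝓝 (Φ u₀ z₀))) : Tendsto u l (𝓝 u₀) := by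
  have hw₀ := norm_pos_iff.2 (hΦ.linear.map_ne_zero u₀ hz₀)
  have hz₀' := norm_pos_iff.2 hz₀
  set a := ‖z₀‖
  set b := ‖Φ u₀ z₀‖
  -- The factor `4` allows both norms to be off by a factor `2` near the limit.
  set κ := min (b / (4 * a)) (a / (4 * b)) with hκ
  have hκ0 : 0 < κ := by positivity
  have hκ1 : κ * (4 * a) ≤ b := (le_div_iff₀ (by positivity)).1 (min_le_left _ _)
  have hκ2 : κ * (4 * b) ≤ a := (le_div_iff₀ (by positivity)).1 (min_le_right _ _)
  obtain ⟨R, -, hR⟩ := hΦ.exists_abs_time_le hκ0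
  have hb : ∀ᶠ i in l, u i ∈ Icc (-R) R := by
    filter_upwards [hz.norm.eventually_lt_const (show a < 2 * a by linarith),
      hz.norm.eventually_const_lt (show a / 2 < a by linarith),
      hu.norm.eventually_lt_const (show b < 2 * b by linarith),
      hu.norm.eventually_const_lt (show b / 2 < b by linarith)] with i h1 h2 h3 h4
    refine abs_le.1 (hR _ (z i) (norm_pos_iff.1 (by linarith)) ?_ ?_) <;> nlinarith
  refine (isCompact_Icc (a := -R) (b := R)).tendsto_nhds_of_unique_mapClusterPt hb ?_
  intro v _ hv
  obtain ⟨U, hU, hUv⟩ := mapClusterPt_iff_ultrafilter.1 hv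
  have h1 : Tendsto (fun i => Φ (u i) (z i)) U (𝓝 (Φ v z₀)) :=
    (Φ.cont'.tendsto (v, z₀)).comp (hUv.prodMk_nhds (hz.mono_left hU))
  exact hΦ.flow_injective hz₀ (tendsto_nhds_unique h1 (hu.mono_left hU))

/-- The determinant of a stable flow on a nontrivial space is `exp (-a t)` with `a > 0`. -/
theorem IsStable.exists_abs_det_eq_exp [Nontrivial X] {Φ : Flow ℝ X} (hΦ : IsStable Φ) :
    ∃ a : ℝ, 0 < a ∧ ∀ t, |(hΦ.linear.clm t).det| = Real.exp (-(a * t)) := by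
  have hadd : ∀ s t, (hΦ.linear.clm (s + t)).det
      = (hΦ.linear.clm s).det * (hΦ.linear.clm t).det := fun s t => by
    rw [hΦ.linear.clm_add]
    exact LinearMap.det_comp _ _
  have h0 : (hΦ.linear.clm 0).det = 1 := by
    rw [hΦ.linear.clm_zero]
    exact LinearMap.det_id
  have hne : ∀ t, (hΦ.linear.clm t).det ≠ 0 := fun t h => by
    have := hadd t (-t)
    rw [add_neg_cancel, h0, h, zero_mul] at this
    exact one_ne_zero this
  have hcont : Continuous fun t => (hΦ.linear.clm t).det :=
    ContinuousLinearMap.continuous_det.comp hΦ.linear.continuous_clm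
  let f : ℝ →+ ℝ :=
    { toFun := fun t => Real.log |(hΦ.linear.clm t).det|
      map_zero' := by simp [h0]
      map_add' := fun s t => by
        rw [hadd, abs_mul, Real.log_mul (abs_ne_zero.2 (hne s)) (abs_ne_zero.2 (hne t))] }
  have hf : Continuous f := hcont.abs.log fun t => abs_ne_zero.2 (hne t)
  have hlin : ∀ t : ℝ, Real.log |(hΦ.linear.clm t).det| = t * f 1 := fun t => by
    have := map_real_smul f hf t 1
    simpa [f] using this
  have hexp : ∀ t, |(hΦ.linear.clm t).det| = Real.exp (t * f 1) := fun t => by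
    rw [← hlin, Real.exp_log (abs_pos.2 (hne t))]
  refine ⟨-f 1, ?_, fun t => by rw [hexp]; ring_nf⟩
  have hdet0 : (0 : X →L[ℝ] X).det = 0 := LinearMap.det_zero'' 
  -- The sign of the rate: `Φ t → 0` forces the determinant to `0`, hence below `1` at some positive
  -- time.
  have hlim := ((ContinuousLinearMap.continuous_det.tendsto
    (0 : X →L[ℝ] X)).comp hΦ.tendsto_clm).abs
  rw [hdet0, abs_zero] at hlim
  obtain ⟨t, ht, ht0⟩ := ((hlim.eventually_lt_const one_pos).and (eventually_gt_atTop 0)).exists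
  simp only [Function.comp_apply, hexp, Real.exp_lt_one_iff] at ht
  nlinarith

/-- A stable flow decays exponentially. -/
theorem IsStable.exists_exp_bound {Φ : Flow ℝ X} (hΦ : IsStable Φ) :
    ∃ c C : ℝ, 0 < c ∧ 0 < C ∧ ∀ t, 0 ≤ t → ∀ x, ‖Φ t x‖ ≤ C * Real.exp (-(c * t)) * ‖x‖ := by
  obtain ⟨T, hT0, hT⟩ := hΦ.exists_contraction (Real.exp_pos (-1))
  obtain ⟨C, hC0, hC⟩ := hΦ.exists_bound
  have hn : ∀ (n : ℕ) (x : X), ‖Φ (n * T) x‖ ≤ Real.exp (-n) * ‖x‖ := by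
    intro n
    induction n with
    | zero => simp
    | succ n ih =>
      intro x
      rw [Nat.cast_succ, add_mul, one_mul, add_comm, Φ.map_add]
      calc _ ≤ Real.exp (-1) * ‖Φ (n * T) x‖ := hT T le_rfl _
        _ ≤ Real.exp (-1) * (Real.exp (-n) * ‖x‖) :=
          mul_le_mul_of_nonneg_left (ih x) (Real.exp_pos _).le
        _ = _ := by rw [← mul_assoc, ← Real.exp_add]; congr 2; ring
  -- Each period `T` gains a factor `exp (-1)`; the extra `exp 1` pays for rounding `t / T` down.
  refine ⟨1 / T, C * Real.exp 1, by positivity, by positivity, fun t ht x => ?_⟩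
  set n := ⌊t / T⌋₊
  have h1 : (n : ℝ) * T ≤ t := (le_div_iff₀ hT0).1 (Nat.floor_le (by positivity))
  have h2 : t / T < n + 1 := Nat.lt_floor_add_one _
  calc ‖Φ t x‖ = ‖Φ (t - n * T) (Φ (n * T) x)‖ := by rw [← Φ.map_add, sub_add_cancel]
    _ ≤ C * (Real.exp (-n) * ‖x‖) :=
      (hC _ (by linarith) _).trans (mul_le_mul_of_nonneg_left (hn n x) hC0.le)
    _ ≤ C * (Real.exp (1 + -(1 / T * t)) * ‖x‖) := by
      gcongr
      rw [one_div, inv_mul_eq_div]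
      linarith
    _ = _ := by rw [Real.exp_add]; ring

theorem IsStable.measure_image [MeasurableSpace X] [BorelSpace X] (μ : Measure X)
    [μ.IsAddHaarMeasure] {Φ : Flow ℝ X} (hΦ : IsStable Φ) {a : ℝ}
    (ha : ∀ t, |(hΦ.linear.clm t).det| = Real.exp (-(a * t))) (t : ℝ) (s : Set X) :
    μ (Φ t '' s) = ENNReal.ofReal (Real.exp (-(a * t))) * μ s := by
  rw [← ha t]
  exact Measure.addHaar_image_continuousLinearMap μ (hΦ.linear.clm t) s

end LinearFlow

/-! ### The homeomorphism near the origin and the cocycle rule. -/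

section Homeomorph

variable {X : Type*} [NormedAddCommGroup X] {Φ Ψ : Flow ℝ X} {h : X ≃ₜ X} {x : X} {τ : ℝ → ℝ}

theorem homeomorph_ne_zero (h0 : h 0 = 0) (hx : x ≠ 0) : h x ≠ 0 := fun hh =>
  hx (h.injective (hh.trans h0.symm))

/-- Cocycle property: the time reparametrization at a point further along the orbit. -/
theorem IsTimeReparam.shift (hτ : IsTimeReparam Φ Ψ h x τ) (s : ℝ) :
    IsTimeReparam Φ Ψ h (Φ s x) (fun t => τ (t + s) - τ s) where
  continuous := by
    have := hτ.continuous
    fun_prop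
  bijective := by
    have h1 : Function.Bijective fun t : ℝ => t + s := (Equiv.addRight s).bijective
    have h2 : Function.Bijective fun t : ℝ => t - τ s := (Equiv.subRight (τ s)).bijective
    exact h2.comp (hτ.bijective.comp h1)
  map_zero := by simp
  map_orbit t := by
    rw [← Φ.map_add, hτ.map_orbit, hτ.map_orbit, ← Ψ.map_add, sub_add_cancel]

/-- Points where both bi-Lipschitz estimates apply. -/
def goodRegion (h : X ≃ₜ X) (r : ℝ) : Set X := {z | ‖z‖ < r ∧ ‖h z‖ < r}

theorem goodRegion_mem_nhds (h0 : h 0 = 0) {r : ℝ} (hr : 0 < r) : goodRegion h r ∈ 𝓝 (0 : X) := by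
  have h1 : Tendsto (fun z : X => ‖z‖) (𝓝 0) (𝓝 0) := tendsto_norm_zero
  have h2 : Tendsto (fun z : X => ‖h z‖) (𝓝 0) (𝓝 0) := by
    simpa [h0] using (h.continuous.tendsto 0).norm
  exact (h1.eventually_lt_const hr).and (h2.eventually_lt_const hr)

theorem norm_le_of_mem_goodRegion (h0 : h 0 = 0) {r : ℝ} {K : NNReal}
    (hK : LipschitzOnWith K h (Metric.ball 0 r)) {z : X} (hz : z ∈ goodRegion h r) :
    ‖h z‖ ≤ K * ‖z‖ := by
  have hr : 0 < r := (norm_nonneg _).trans_lt hz.1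
  simpa [h0] using hK.norm_sub_le (mem_ball_zero_iff.2 hz.1) (Metric.mem_ball_self hr)

theorem norm_le_of_mem_goodRegion_symm (h0 : h 0 = 0) {r : ℝ} {K : NNReal}
    (hK : LipschitzOnWith K h.symm (Metric.ball 0 r)) {z : X} (hz : z ∈ goodRegion h r) :
    ‖z‖ ≤ K * ‖h z‖ := by
  have hr : 0 < r := (norm_nonneg _).trans_lt hz.1
  have h0' : h.symm 0 = 0 := h.symm_apply_eq.2 h0.symm
  simpa [h0'] using hK.norm_sub_le (mem_ball_zero_iff.2 hz.2) (Metric.mem_ball_self hr)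

end Homeomorph

/-! ### Existence, monotonicity and continuity of time changes. -/

section TimeReparam

variable {X : Type*} [NormedAddCommGroup X] [NormedSpace ℝ X] [FiniteDimensional ℝ X]
  {Φ Ψ : Flow ℝ X} {h : X ≃ₜ X} {x : X} {τ τ' : ℝ → ℝ}

theorem IsTimeReparam.unique (hΨ : IsStable Ψ) (h0 : h 0 = 0) (hx : x ≠ 0)
    (hτ : IsTimeReparam Φ Ψ h x τ) (hτ' : IsTimeReparam Φ Ψ h x τ') : τ = τ' :=
  funext fun t => hΨ.flow_injective (homeomorph_ne_zero h0 hx)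
    ((hτ.map_orbit t).symm.trans (hτ'.map_orbit t))

theorem IsRelated.exists_isTimeReparam (hrel : IsRelated Φ Ψ h) (hΦ : IsStable Φ)
    (hΨ : IsStable Ψ) (h0 : h 0 = 0) (hx : x ≠ 0) : ∃ τ, IsTimeReparam Φ Ψ h x τ := by
  have hhx := homeomorph_ne_zero h0 hx
  have h1 : ∀ t, ∃ s, Ψ s (h x) = h (Φ t x) := fun t => by
    have : h (Φ t x) ∈ Ψ.orbit (h x) := by
      rw [← hrel x]
      exact mem_image_of_mem h (Φ.mem_orbit x t)
    exact this
  choose τ hτ using h1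
  refine ⟨τ, ?_, ⟨?_, ?_⟩, ?_, fun t => (hτ t).symm⟩
  · rw [continuous_iff_continuousAt]
    intro t
    refine hΨ.tendsto_time hhx (z := fun _ => h x) tendsto_const_nhds ?_
    simp only [hτ]
    exact (h.continuous.comp (Φ.continuous continuous_id continuous_const)).continuousAt
  · intro s t hst
    apply hΦ.flow_injective hx
    apply h.injective
    simp only [← hτ, hst]
  · intro s
    have h2 : Ψ s (h x) ∈ h '' Φ.orbit x := by
      rw [hrel x]
      exact Ψ.mem_orbit _ s
    obtain ⟨_, ⟨t, rfl⟩, ht⟩ := h2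
    refine ⟨t, hΨ.flow_injective hhx ?_⟩
    exact (hτ t).trans ht
  · apply hΨ.flow_injective hhx
    simp only [hτ, Φ.map_zero_apply, Ψ.map_zero_apply]

/-- If `τ` were decreasing, `h x` would be reached from `h (Φ t x)` in forward `Ψ`-time; the forward
bound and `h (Φ t x) → 0` would then give `h x = 0`. -/
theorem IsTimeReparam.strictMono (hτ : IsTimeReparam Φ Ψ h x τ) (hΦ : IsStable Φ)
    (hΨ : IsStable Ψ) (h0 : h 0 = 0) (hx : x ≠ 0) : StrictMono τ := by
  refine (hτ.continuous.strictMono_of_inj hτ.bijective.injective).resolve_right fun hanti => ?_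
  have hhx := norm_pos_iff.2 (homeomorph_ne_zero h0 hx)
  obtain ⟨C, hC0, hC⟩ := hΨ.exists_bound
  have hlim : Tendsto (fun t => C * ‖h (Φ t x)‖) atTop (𝓝 0) := by
    have := ((h.continuous.tendsto 0).comp (hΦ.tendsto_zero x)).norm.const_mul C
    simpa [h0] using this
  obtain ⟨t, ht, ht0⟩ :=
    ((hlim.eventually_lt_const hhx).and (eventually_ge_atTop 0)).exists
  have h1 : τ t ≤ 0 := hτ.map_zero ▸ hanti.antitone ht0
  have h2 := hC (-τ t) (by linarith) (Ψ (τ t) (h x))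
  rw [flow_neg_flow, ← hτ.map_orbit] at h2
  linarith

theorem tendsto_timeReparam (hΨ : IsStable Ψ) (h0 : h 0 = 0) {θ : X → ℝ → ℝ}
    (hθ : ∀ y, y ≠ 0 → IsTimeReparam Φ Ψ h y (θ y)) (hx : x ≠ 0) (t : ℝ) :
    Tendsto (fun y => θ y t) (𝓝 x) (𝓝 (θ x t)) := by
  refine hΨ.tendsto_time (homeomorph_ne_zero h0 hx) h.continuous.continuousAt ?_
  rw [← (hθ x hx).map_orbit]
  refine Tendsto.congr' (f₁ := fun y => h (Φ t y)) ?_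
    (h.continuous.comp (Φ.continuous continuous_const continuous_id)).continuousAt
  filter_upwards [eventually_ne_nhds hx] with y hy
  exact (hθ y hy).map_orbit t

/-- Lyapunov stability; it keeps whole forward orbits where both Lipschitz estimates apply. -/
theorem IsStable.exists_forward_mem (hΦ : IsStable Φ) {G : Set X} (hG : G ∈ 𝓝 (0 : X)) :
    ∃ ρ : ℝ, 0 < ρ ∧ ∀ y, ‖y‖ < ρ → ∀ t, 0 ≤ t → Φ t y ∈ G := by
  obtain ⟨δ, hδ, hδG⟩ := Metric.mem_nhds_iff.1 hG
  obtain ⟨C, hC0, hC⟩ := hΦ.exists_bound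
  refine ⟨δ / C, by positivity, fun y hy t ht => hδG (mem_ball_zero_iff.2 ?_)⟩
  rw [lt_div_iff₀ hC0] at hy
  linarith [hC t ht y]

/-- A fixed amount of `Φ`-time corresponds to a `Ψ`-time in a fixed compact interval. -/
theorem exists_step_bounds (hΦ : IsStable Φ) (hΨ : IsStable Ψ) (h0 : h 0 = 0) {r : ℝ} {K : NNReal}
    (hK : LipschitzOnWith K h (Metric.ball 0 r))
    (hK' : LipschitzOnWith K h.symm (Metric.ball 0 r)) :
    ∃ σ C : ℝ, 0 < σ ∧ ∀ x τ, x ≠ 0 → IsTimeReparam Φ Ψ h x τ → ∀ t,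
      Φ t x ∈ goodRegion h r → Φ (σ + t) x ∈ goodRegion h r →
      1 ≤ τ (σ + t) - τ t ∧ τ (σ + t) - τ t ≤ C := by
  set k : ℝ := K + 1 with hk
  have hk0 : 0 < k := by positivity
  have hle : ∀ z ∈ goodRegion h r, ‖h z‖ ≤ k * ‖z‖ := fun z hz =>
    (norm_le_of_mem_goodRegion h0 hK hz).trans
      (mul_le_mul_of_nonneg_right (by linarith) (norm_nonneg _))
  have hle' : ∀ z ∈ goodRegion h r, ‖z‖ ≤ k * ‖h z‖ := fun z hz =>
    (norm_le_of_mem_goodRegion_symm h0 hK' hz).trans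
      (mul_le_mul_of_nonneg_right (by linarith) (norm_nonneg _))
  obtain ⟨C₁, hC₁0, hC₁⟩ := hΨ.linear.exists_bound_Icc (-1) 0
  -- Undoing a `Ψ`-time below `1` costs at most `C₁`, and the passages through `h` and its inverse
  -- cost `k ^ 2`; the contraction beats their product by a factor `2`.
  obtain ⟨σ, hσ0, hσ⟩ := hΦ.exists_contraction (ε := 1 / (2 * C₁ * k ^ 2)) (by positivity)
  obtain ⟨C₂, hC₂0, hC₂⟩ := hΦ.linear.exists_bound_Icc (-σ) 0
  -- Going back by `Φ`-time `σ` costs `C₂`, so `h z` shrinks by at most `k ^ 2 * C₂`, which bounds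
  -- the `Ψ`-time.
  obtain ⟨R, -, hR⟩ := hΨ.exists_time_le (κ := 1 / (k ^ 2 * C₂)) (by positivity)
  refine ⟨σ, R, hσ0, fun x τ hx hτ t hz hz' => ?_⟩
  set z := Φ t x
  have hz0 : z ≠ 0 := hΦ.linear.map_ne_zero t hx
  have hhz0 := homeomorph_ne_zero h0 hz0
  have hhz : 0 < ‖h z‖ := norm_pos_iff.2 hhz0
  have hmono := (hτ.strictMono hΦ hΨ h0 hx).monotone (show t ≤ σ + t by linarith)
  set w := τ (σ + t) - τ t with hw
  have hwz : h (Φ σ z) = Ψ w (h z) := (hτ.shift t).map_orbit σ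
  rw [Φ.map_add] at hz'
  constructor
  · by_contra! hlt
    have h1 := hC₁ (-w) ⟨by linarith, by linarith⟩ (Ψ w (h z))
    rw [flow_neg_flow, ← hwz] at h1
    have h2 : ‖h z‖ ≤ C₁ * (k * (1 / (2 * C₁ * k ^ 2) * (k * ‖h z‖))) := by
      refine h1.trans ?_
      gcongr
      refine (hle _ hz').trans ?_
      gcongr
      refine (hσ σ le_rfl z).trans ?_
      gcongr
      exact hle' z hz
    have h3 : C₁ * (k * (1 / (2 * C₁ * k ^ 2) * (k * ‖h z‖))) = ‖h z‖ / 2 := by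
      field_simp
    linarith
  · refine hR w (h z) hhz0 ?_
    have h1 := hC₂ (-σ) ⟨le_rfl, by linarith⟩ (Φ σ z)
    rw [flow_neg_flow] at h1
    have h2 : ‖h z‖ ≤ k * (C₂ * (k * ‖h (Φ σ z)‖)) := by
      refine (hle z hz).trans ?_
      gcongr
      refine h1.trans ?_
      gcongr
      exact hle' _ hz'
    rw [hwz] at h2
    rw [one_div, inv_mul_le_iff₀ (by positivity)]
    linarith

end TimeReparam

/-! ### Inclusions between flow tubes. -/

section Tube

variable {X : Type*} [NormedAddCommGroup X] [NormedSpace ℝ X] [FiniteDimensional ℝ X]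
  {Φ Ψ : Flow ℝ X} {h : X ≃ₜ X}

/-- The tube swept out by a set during a time interval. -/
def tube (Φ : Flow ℝ X) (a b : ℝ) (S : Set X) : Set X := image2 (fun t y => Φ t y) (Icc a b) S

/-- The window `[1/4, 3/4]` leaves a margin of `1/4` at each end of a step of `Ψ`-length at least
`1`, absorbing the variation of `θ y t` over `S`. -/
theorem image_tube_subset_image_tube (hΦ : IsStable Φ) (hΨ : IsStable Ψ) (h0 : h 0 = 0)
    {S : Set X} (hS : ∀ y ∈ S, y ≠ 0) {θ : X → ℝ → ℝ}
    (hθ : ∀ y, y ≠ 0 → IsTimeReparam Φ Ψ h y (θ y)) {σ t T : ℝ}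
    (hstep : ∀ y ∈ S, 1 ≤ θ y (σ + t) - θ y t) (hT : ∀ y ∈ S, |θ y t - T| ≤ 1 / 4) :
    Ψ T '' tube Ψ (1 / 4) (3 / 4) (h '' S) ⊆ h '' (Φ t '' tube Φ 0 σ S) := by
  rintro _ ⟨_, ⟨s, hs, _, ⟨y, hy, rfl⟩, rfl⟩, rfl⟩
  have hm := (hθ y (hS y hy)).strictMono hΦ hΨ h0 (hS y hy)
  obtain ⟨v, hv⟩ := (hθ y (hS y hy)).bijective.surjective (T + s)
  have h1 := hstep y hy
  have h2 := abs_le.1 (hT y hy)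
  have h3 : t ≤ v := hm.le_iff_le.1 (by rw [hv]; linarith [hs.1])
  have h4 : v ≤ σ + t := hm.le_iff_le.1 (by rw [hv]; linarith [hs.2])
  refine ⟨_, ⟨_, ⟨v - t, ⟨by linarith, by linarith⟩, y, hy, rfl⟩, rfl⟩, ?_⟩
  dsimp only
  rw [← Φ.map_add, add_sub_cancel, (hθ y (hS y hy)).map_orbit, hv, Ψ.map_add]

/-- Half-unit shifts of the window `[1/4, 3/4]`, starting with shift `-1/2`, cover every time offset
from `-1/4` to `C + 1/4`. -/
theorem image_tube_subset_iUnion (hΦ : IsStable Φ) (hΨ : IsStable Ψ) (h0 : h 0 = 0)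
    {S : Set X} (hS : ∀ y ∈ S, y ≠ 0) {θ : X → ℝ → ℝ}
    (hθ : ∀ y, y ≠ 0 → IsTimeReparam Φ Ψ h y (θ y)) {σ t T C : ℝ} {N : ℕ} (hN : 2 * C + 1 ≤ N)
    (hstep : ∀ y ∈ S, θ y (σ + t) - θ y t ≤ C) (hT : ∀ y ∈ S, |θ y t - T| ≤ 1 / 4) :
    h '' (Φ t '' tube Φ 0 σ S) ⊆
      Ψ T '' ⋃ k ∈ Finset.range (N + 1),
        Ψ (((k : ℝ) - 1) / 2) '' tube Ψ (1 / 4) (3 / 4) (h '' S) := by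
  rintro _ ⟨_, ⟨_, ⟨s, hs, y, hy, rfl⟩, rfl⟩, rfl⟩
  have hm := ((hθ y (hS y hy)).strictMono hΦ hΨ h0 (hS y hy)).monotone
  have h1 := hstep y hy
  have h2 := abs_le.1 (hT y hy)
  have h3 : θ y t ≤ θ y (t + s) := hm (by linarith [hs.1])
  have h4 : θ y (t + s) ≤ θ y (σ + t) := hm (by linarith [hs.2])
  set w := θ y (t + s) - T with hw
  set k := ⌊2 * w + 1 / 2⌋₊ with hk
  have h5 : (k : ℝ) ≤ 2 * w + 1 / 2 := Nat.floor_le (by linarith)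
  have h6 : 2 * w + 1 / 2 < k + 1 := Nat.lt_floor_add_one _
  have h7 : k < N + 1 := by
    have : (k : ℝ) < N + 1 := by linarith
    exact_mod_cast this
  refine ⟨Ψ (((k : ℝ) - 1) / 2) (Ψ (w - (k - 1) / 2) (h y)), mem_biUnion (Finset.mem_range.2 h7)
    ⟨_, ⟨w - (k - 1) / 2, ⟨by linarith, by linarith⟩, h y, mem_image_of_mem h hy, rfl⟩, rfl⟩, ?_⟩
  dsimp only
  rw [← Φ.map_add, (hθ y (hS y hy)).map_orbit, ← Ψ.map_add, ← Ψ.map_add]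
  congr 1
  rw [hw]
  ring

end Tube

/-! ### Volume comparison and the common speed. -/

section Volume

variable {X : Type*} [NormedAddCommGroup X] [NormedSpace ℝ X] [FiniteDimensional ℝ X]
  {Φ Ψ : Flow ℝ X} {h : X ≃ₜ X}

/-- Volume comparison along a bi-Lipschitz orbit equivalence: near the origin, the determinants of
`Φ t` and of `Ψ (τ t)` agree up to a uniform factor. -/
theorem exists_volume_comparison (hΦ : IsStable Φ) (hΨ : IsStable Ψ)
    (hLip : IsBiLipschitzNearZero h) {θ : X → ℝ → ℝ}
    (hθ : ∀ y, y ≠ 0 → IsTimeReparam Φ Ψ h y (θ y)) {a b : ℝ}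
    (ha : ∀ t, |(hΦ.linear.clm t).det| = Real.exp (-(a * t)))
    (hb : ∀ t, |(hΨ.linear.clm t).det| = Real.exp (-(b * t))) :
    ∃ Q ρ : ℝ, 0 < Q ∧ 0 < ρ ∧ ∀ x, x ≠ 0 → ‖x‖ < ρ → ∀ t, 0 ≤ t →
      Real.exp (-(b * θ x t)) ≤ Q * Real.exp (-(a * t)) ∧
      Real.exp (-(a * t)) ≤ Q * Real.exp (-(b * θ x t)) := by
  borelize X
  obtain ⟨h0, r, hr, K, hK, hK'⟩ := hLip
  -- Hausdorff measure of full dimension is a Haar measure, so determinants scale it, and Lipschitz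
  -- maps distort it by at most `K ^ dim X`.
  set μ : Measure X := μH[finrank ℝ X]
  obtain ⟨ρ, hρ0, hρ⟩ := hΦ.exists_forward_mem (goodRegion_mem_nhds h0 hr)
  obtain ⟨σ, C, hσ0, hσ⟩ := exists_step_bounds hΦ hΨ h0 hK hK'
  obtain ⟨N, hN⟩ := exists_nat_ge (2 * C + 1)
  set k : ENNReal := (K : ENNReal) ^ (finrank ℝ X : ℝ)
  have hk : k ≠ ⊤ := ENNReal.rpow_ne_top_of_nonneg (Nat.cast_nonneg _) ENNReal.coe_ne_top
  set M : ENNReal := ∑ i ∈ Finset.range (N + 1),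
    ENNReal.ofReal (Real.exp (-(b * (((i : ℝ) - 1) / 2)))) with hM
  have hMtop : M ≠ ⊤ := ENNReal.sum_ne_top.2 fun _ _ => ENNReal.ofReal_ne_top
  have hLipμ : ∀ s ⊆ goodRegion h r, μ (h '' s) ≤ k * μ s := fun s hs =>
    (hK.mono fun z hz => mem_ball_zero_iff.2 (hs hz).1).hausdorffMeasure_image_le
      (Nat.cast_nonneg _)
  have hLipμ' : ∀ s ⊆ goodRegion h r, μ s ≤ k * μ (h '' s) := fun s hs => by
    have h1 : LipschitzOnWith K h.symm (h '' s) := hK'.mono (by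
      rintro _ ⟨z, hz, rfl⟩
      exact mem_ball_zero_iff.2 (hs hz).2)
    have h2 := h1.hausdorffMeasure_image_le (d := (finrank ℝ X : ℝ)) (Nat.cast_nonneg _)
    have h3 : h.symm '' (h '' s) = s := h.toEquiv.symm_image_image s
    rwa [h3] at h2
  set Q : ENNReal := k * k * M
  have hQ : Q ≠ ⊤ := ENNReal.mul_ne_top (ENNReal.mul_ne_top hk hk) hMtop
  refine ⟨Q.toReal + 1, ρ, by positivity, hρ0, fun x hx hxρ t ht => ?_⟩
  have hnhds : ∀ᶠ y in 𝓝 x, y ≠ 0 ∧ ‖y‖ < ρ ∧ |θ y t - θ x t| ≤ 1 / 4 := by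
    refine (eventually_ne_nhds hx).and
      ((continuous_norm.continuousAt.eventually_lt continuousAt_const hxρ).and ?_)
    filter_upwards [Metric.tendsto_nhds.1 (tendsto_timeReparam hΨ h0 hθ hx t) (1 / 4)
      (by norm_num)] with y hy
    exact hy.le
  -- The radius depends on `x` and `t`; this is harmless, since `Q` does not involve it.
  obtain ⟨ε, hε0, hε⟩ := Metric.eventually_nhds_iff_ball.1 hnhds
  set S := Metric.ball x ε
  set U := tube Φ 0 σ S
  set W := tube Ψ (1 / 4) (3 / 4) (h '' S)
  have hS : ∀ y ∈ S, y ≠ 0 := fun y hy => (hε y hy).1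
  have hSg : ∀ y ∈ S, ∀ s, 0 ≤ s → Φ s y ∈ goodRegion h r := fun y hy => hρ y (hε y hy).2.1
  have hstep : ∀ s, 0 ≤ s → ∀ y ∈ S, 1 ≤ θ y (σ + s) - θ y s ∧ θ y (σ + s) - θ y s ≤ C :=
    fun s hs y hy => hσ y _ (hS y hy) (hθ y (hS y hy)) s (hSg y hy s hs)
      (hSg y hy _ (by linarith))
  have hUg : ∀ s, 0 ≤ s → Φ s '' U ⊆ goodRegion h r := by
    rintro s hs _ ⟨_, ⟨v, hv, y, hy, rfl⟩, rfl⟩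
    dsimp only
    rw [← Φ.map_add]
    exact hSg y hy _ (by linarith [hv.1])
  have hlow : ∀ s T, 0 ≤ s → (∀ y ∈ S, |θ y s - T| ≤ 1 / 4) →
      ENNReal.ofReal (Real.exp (-(b * T))) * μ W ≤ μ (h '' (Φ s '' U)) := by
    intro s T hs hT
    rw [← hΨ.measure_image μ hb]
    exact measure_mono (image_tube_subset_image_tube hΦ hΨ h0 hS hθ
      (fun y hy => (hstep s hs y hy).1) hT)
  have hupp : ∀ s T, 0 ≤ s → (∀ y ∈ S, |θ y s - T| ≤ 1 / 4) →
      μ (h '' (Φ s '' U)) ≤ ENNReal.ofReal (Real.exp (-(b * T))) * (M * μ W) := by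
    intro s T hs hT
    refine (measure_mono (image_tube_subset_iUnion hΦ hΨ h0 hS hθ hN
      (fun y hy => (hstep s hs y hy).2) hT)).trans ?_
    rw [hΨ.measure_image μ hb, hM, Finset.sum_mul]
    gcongr
    refine (measure_biUnion_finset_le _ _).trans (le_of_eq ?_)
    exact Finset.sum_congr rfl fun i _ => hΨ.measure_image μ hb _ _
  have hT0 : ∀ y ∈ S, |θ y 0 - 0| ≤ 1 / 4 := fun y hy => by
    rw [(hθ y (hS y hy)).map_zero]
    norm_num
  have hTt : ∀ y ∈ S, |θ y t - θ x t| ≤ 1 / 4 := fun y hy => (hε y hy).2.2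
  have hU0 : Φ 0 '' U = U := by simp
  have hUg0 : U ⊆ goodRegion h r := hU0 ▸ hUg 0 le_rfl
  have hlow0 : μ W ≤ μ (h '' U) := by simpa using hlow 0 0 le_rfl hT0
  have hupp0 : μ (h '' U) ≤ M * μ W := by simpa using hupp 0 0 le_rfl hT0
  have hlowt := hlow t _ ht hTt
  have huppt := hupp t _ ht hTt
  have hmt : μ (Φ t '' U) = ENNReal.ofReal (Real.exp (-(a * t))) * μ U :=
    hΦ.measure_image μ ha t U
  have hUpos : μ U ≠ 0 := by
    have hsub : S ⊆ U := fun y hy => ⟨0, ⟨le_rfl, hσ0.le⟩, y, hy, Φ.map_zero_apply y⟩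
    exact ((Metric.measure_ball_pos μ x hε0).trans_le (measure_mono hsub)).ne'
  have hUfin : μ U ≠ ⊤ := by
    have hsub : U ⊆ Metric.ball 0 r := fun z hz => mem_ball_zero_iff.2 (hUg0 hz).1
    exact ((measure_mono hsub).trans_lt measure_ball_lt_top).ne
  -- Time `0` trades `μ U` for `μ W` and time `t` trades it back, so `μ U` cancels.
  have key1 : ENNReal.ofReal (Real.exp (-(b * θ x t))) ≤
      Q * ENNReal.ofReal (Real.exp (-(a * t))) := by
    refine (ENNReal.mul_le_mul_iff_left hUpos hUfin).1 ?_
    set e := ENNReal.ofReal (Real.exp (-(b * θ x t)))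
    calc e * μ U ≤ e * (k * (M * μ W)) := by
          gcongr
          exact (hLipμ' U hUg0).trans (by gcongr)
      _ = k * M * (e * μ W) := by ring
      _ ≤ k * M * (k * (ENNReal.ofReal (Real.exp (-(a * t))) * μ U)) := by
          rw [← hmt]
          exact mul_le_mul_right (hlowt.trans (hLipμ _ (hUg t ht))) _
      _ = _ := by ring
  have key2 : ENNReal.ofReal (Real.exp (-(a * t))) ≤
      Q * ENNReal.ofReal (Real.exp (-(b * θ x t))) := by
    refine (ENNReal.mul_le_mul_iff_left hUpos hUfin).1 ?_
    set e := ENNReal.ofReal (Real.exp (-(b * θ x t)))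
    rw [← hmt]
    calc μ (Φ t '' U) ≤ k * (e * (M * μ W)) := (hLipμ' _ (hUg t ht)).trans (by gcongr)
      _ ≤ k * (e * (M * (k * μ U))) := by
          gcongr
          exact hlow0.trans (hLipμ U hUg0)
      _ = _ := by ring
  have conv : ∀ p q : ℝ, ENNReal.ofReal (Real.exp p) ≤ Q * ENNReal.ofReal (Real.exp q) →
      Real.exp p ≤ (Q.toReal + 1) * Real.exp q := by
    intro p q hpq
    rw [← ENNReal.ofReal_toReal hQ, ← ENNReal.ofReal_mul ENNReal.toReal_nonneg,
      ENNReal.ofReal_le_ofReal_iff (by positivity)] at hpq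
    linarith [Real.exp_pos q]
  exact ⟨conv _ _ key1, conv _ _ key2⟩

/-- There is a common speed `α` such that every time reparametrization stays at bounded distance
from `α t` in forward time. -/
theorem exists_speed [Nontrivial X] (hΦ : IsStable Φ) (hΨ : IsStable Ψ)
    (hLip : IsBiLipschitzNearZero h) (hrel : IsRelated Φ Ψ h) :
    ∃ α : ℝ, 0 < α ∧ ∀ x τ, x ≠ 0 → IsTimeReparam Φ Ψ h x τ →
      ∃ D : ℝ, ∀ t, 0 ≤ t → |τ t - α * t| ≤ D := by
  obtain ⟨a, ha0, ha⟩ := hΦ.exists_abs_det_eq_exp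
  obtain ⟨b, hb0, hb⟩ := hΨ.exists_abs_det_eq_exp
  have hex : ∀ y, ∃ τ, y ≠ 0 → IsTimeReparam Φ Ψ h y τ := fun y => by
    by_cases hy : y = 0
    · exact ⟨id, fun hy' => (hy' hy).elim⟩
    · obtain ⟨τ, hτ⟩ := hrel.exists_isTimeReparam hΦ hΨ hLip.1 hy
      exact ⟨τ, fun _ => hτ⟩
  choose θ hθ using hex
  obtain ⟨Q, ρ, hQ, hρ, hQρ⟩ := exists_volume_comparison hΦ hΨ hLip hθ ha hb
  refine ⟨a / b, by positivity, fun x τ hx hτ => ?_⟩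
  have hlim := (hΦ.tendsto_zero x).norm
  rw [norm_zero] at hlim
  obtain ⟨s, hs, hs0⟩ := ((hlim.eventually_lt_const hρ).and (eventually_ge_atTop 0)).exists
  have hx' := hΦ.linear.map_ne_zero s hx
  have heq : θ (Φ s x) = fun t => τ (t + s) - τ s :=
    (hθ _ hx').unique hΨ hLip.1 hx' (hτ.shift s)
  have hcont : Continuous fun t => |τ t - a / b * t| := by
    have := hτ.continuous
    fun_prop
  obtain ⟨D, hD⟩ := (isCompact_Icc (a := 0) (b := s)).exists_bound_of_continuousOn
    hcont.continuousOn
  have hfar : ∀ t, s ≤ t → |τ t - a / b * t| ≤ Real.log Q / b + D := by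
    intro t ht
    obtain ⟨h1, h2⟩ := hQρ _ hx' hs (t - s) (by linarith)
    have elog : ∀ p q : ℝ, Real.exp p ≤ Q * Real.exp q → p ≤ Real.log Q + q := fun p q hpq => by
      rwa [← Real.exp_le_exp, Real.exp_add, Real.exp_log hQ]
    have h1' := elog _ _ h1
    have h2' := elog _ _ h2
    have hDs := hD s ⟨hs0, le_rfl⟩
    rw [Real.norm_eq_abs, abs_abs] at hDs
    rw [heq] at h1' h2'
    simp only [sub_add_cancel] at h1' h2'
    have h3 : |τ t - τ s - a / b * (t - s)| ≤ Real.log Q / b := by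
      have : τ t - τ s - a / b * (t - s) = (b * (τ t - τ s) - a * (t - s)) / b := by
        field_simp
      rw [this, abs_div, abs_of_pos hb0]
      gcongr
      rw [abs_le]
      constructor <;> linarith
    calc |τ t - a / b * t| = |(τ t - τ s - a / b * (t - s)) + (τ s - a / b * s)| := by
          congr 1
          ring
      _ ≤ _ := (abs_add_le _ _).trans (add_le_add h3 hDs)
  refine ⟨max D (Real.log Q / b + D), fun t ht => ?_⟩
  rcases le_total t s with hts | hts
  · have := hD t ⟨ht, hts⟩
    rw [Real.norm_eq_abs, abs_abs] at this
    exact this.trans (le_max_left _ _)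
  · exact (hfar t hts).trans (le_max_right _ _)

end Volume

/-! ### Invariance and rigidity of refined Lyapunov spaces. -/

section Lyapunov

variable {X : Type*} [NormedAddCommGroup X] [NormedSpace ℝ X]
  {Φ Ψ : Flow ℝ X} {h : X ≃ₜ X}

theorem mem_refinedLyapunov_iff {m : ℕ} {s : ℝ} {x : X} : x ∈ refinedLyapunov Φ m s ↔
    Tendsto (fun t : ℝ => (Real.exp (s * t) * t ^ m)⁻¹ * ‖Φ t x‖) atTop (𝓝 0) := by
  rw [refinedLyapunov, mem_ofPred_eq, tendsto_zero_iff_norm_tendsto_zero]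
  refine tendsto_congr' ?_
  filter_upwards [eventually_ge_atTop 0] with t ht
  rw [norm_smul, Real.norm_of_nonneg (by positivity)]

theorem IsLinear.zero_mem_refinedLyapunov (hΦ : IsLinear Φ) (m : ℕ) (s : ℝ) :
    (0 : X) ∈ refinedLyapunov Φ m s := by
  rw [mem_refinedLyapunov_iff]
  simp [hΦ.map_zero]

/-- The condition defining the refined Lyapunov space, after a linear change of time. -/
theorem mem_refinedLyapunov_iff_comp_mul {m : ℕ} {s α : ℝ} (hα : 0 < α) {x : X} :
    x ∈ refinedLyapunov Φ m s ↔
    Tendsto (fun t : ℝ => (Real.exp (α * s * t) * t ^ m)⁻¹ * ‖Φ (α * t) x‖) atTop (𝓝 0) := by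
  have h1 : x ∈ refinedLyapunov Φ m s ↔ Tendsto (fun t : ℝ =>
      (Real.exp (s * (α * t)) * (α * t) ^ m)⁻¹ * ‖Φ (α * t) x‖) atTop (𝓝 0) := by
    rw [mem_refinedLyapunov_iff]
    refine ⟨fun hx => hx.comp (tendsto_id.const_mul_atTop hα), fun hx => ?_⟩
    refine (hx.comp (tendsto_id.const_mul_atTop (inv_pos.2 hα))).congr fun t => ?_
    simp only [Function.comp_apply, id, mul_inv_cancel_left₀ hα.ne']
  rw [h1]
  constructor
  · intro hx
    have := hx.const_mul (α ^ m)
    rw [mul_zero] at this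
    refine this.congr fun t => ?_
    rw [mul_pow, show s * (α * t) = α * s * t by ring, mul_inv, mul_inv, mul_inv]
    field_simp
  · intro hx
    have := hx.const_mul (α ^ m)⁻¹
    rw [mul_zero] at this
    refine this.congr fun t => ?_
    rw [mul_pow, show s * (α * t) = α * s * t by ring, mul_inv, mul_inv, mul_inv]
    ring

theorem tendsto_weight_mul_zero_of_le {m : ℕ} {s C : ℝ} {f g : ℝ → ℝ} (hf0 : ∀ t, 0 ≤ f t)
    (hfg : ∀ᶠ t in atTop, f t ≤ C * g t)
    (hg : Tendsto (fun t : ℝ => (Real.exp (s * t) * t ^ m)⁻¹ * g t) atTop (𝓝 0)) :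
    Tendsto (fun t : ℝ => (Real.exp (s * t) * t ^ m)⁻¹ * f t) atTop (𝓝 0) := by
  have h1 := hg.const_mul C
  rw [mul_zero] at h1
  refine squeeze_zero' ?_ ?_ h1
  · filter_upwards [eventually_ge_atTop 0] with t ht
    have := hf0 t
    positivity
  · filter_upwards [eventually_ge_atTop 0, hfg] with t ht h2
    calc _ ≤ (Real.exp (s * t) * t ^ m)⁻¹ * (C * g t) := by gcongr
      _ = _ := by ring

variable [FiniteDimensional ℝ X]

/-- A time reparametrization at bounded distance from `α t` makes the decay of `Φ t x` comparable
to that of `Ψ (α t) (h x)`. -/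
theorem IsTimeReparam.map_mem_refinedLyapunov_iff (hΦ : IsStable Φ) (hΨ : IsStable Ψ)
    (hLip : IsBiLipschitzNearZero h) {x : X} {τ : ℝ → ℝ} (hτ : IsTimeReparam Φ Ψ h x τ)
    {α D : ℝ} (hα : 0 < α) (hD : ∀ t, 0 ≤ t → |τ t - α * t| ≤ D) (m : ℕ) (s : ℝ) :
    h x ∈ refinedLyapunov Ψ m s ↔ x ∈ refinedLyapunov Φ m (α * s) := by
  obtain ⟨h0, r, hr, K, hK, hK'⟩ := hLip
  obtain ⟨C, hC0, hC⟩ := hΨ.linear.exists_bound_Icc (-D) D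
  have hgood : ∀ᶠ t in atTop, Φ t x ∈ goodRegion h r :=
    hΦ.tendsto_zero x (goodRegion_mem_nhds h0 hr)
  -- Both sides now carry the weight `exp (α s t) t ^ m`, so two-sided comparison of norms up to
  -- constants suffices.
  rw [mem_refinedLyapunov_iff_comp_mul hα, mem_refinedLyapunov_iff]
  constructor
  · refine tendsto_weight_mul_zero_of_le (C := K * C) (fun t => norm_nonneg _) ?_
    filter_upwards [hgood, eventually_ge_atTop 0] with t ht ht0
    have h1 := hC (τ t - α * t) (abs_le.1 (hD t ht0)) (Ψ (α * t) (h x))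
    rw [← Ψ.map_add, sub_add_cancel, ← hτ.map_orbit] at h1
    calc ‖Φ t x‖ ≤ K * ‖h (Φ t x)‖ := norm_le_of_mem_goodRegion_symm h0 hK' ht
      _ ≤ K * (C * ‖Ψ (α * t) (h x)‖) := by gcongr
      _ = _ := by ring
  · refine tendsto_weight_mul_zero_of_le (C := C * K) (fun t => norm_nonneg _) ?_
    filter_upwards [hgood, eventually_ge_atTop 0] with t ht ht0
    have h2 := abs_le.1 (hD t ht0)
    have h1 := hC (α * t - τ t) ⟨by linarith, by linarith⟩ (Ψ (τ t) (h x))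
    rw [← Ψ.map_add, sub_add_cancel, ← hτ.map_orbit] at h1
    calc ‖Ψ (α * t) (h x)‖ ≤ C * ‖h (Φ t x)‖ := h1
      _ ≤ C * (K * ‖Φ t x‖) := by
        gcongr
        exact norm_le_of_mem_goodRegion h0 hK ht
      _ = _ := by ring

/-- Half the uniform exponential decay rate leaves a factor that still tends to `0`. -/
theorem IsStable.exists_refinedLyapunov_eq_univ (hΦ : IsStable Φ) :
    ∃ s < 0, refinedLyapunov Φ 0 s = univ := by
  obtain ⟨c, C, hc0, -, hc⟩ := hΦ.exists_exp_bound
  refine ⟨-(c / 2), by linarith, eq_univ_of_forall fun x => ?_⟩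
  rw [mem_refinedLyapunov_iff]
  have hlim : Tendsto (fun t : ℝ => C * ‖x‖ * Real.exp (-(c / 2 * t))) atTop (𝓝 0) := by
    have := (Real.tendsto_exp_neg_atTop_nhds_zero.comp
      (tendsto_id.const_mul_atTop (half_pos hc0))).const_mul (C * ‖x‖)
    simpa using this
  refine squeeze_zero' (Eventually.of_forall fun t => by positivity) ?_ hlim
  filter_upwards [eventually_ge_atTop 0] with t ht
  rw [pow_zero, mul_one, ← Real.exp_neg]
  calc _ ≤ Real.exp (-(-(c / 2) * t)) * (C * Real.exp (-(c * t)) * ‖x‖) := by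
        gcongr
        exact hc t ht x
    _ = C * ‖x‖ * (Real.exp (-(-(c / 2) * t)) * Real.exp (-(c * t))) := by ring
    _ = _ := by
        rw [← Real.exp_add]
        congr 2
        ring

/-- A linear flow has a lower bound on its exponential decay rates. -/
theorem IsLinear.exists_refinedLyapunov_ne_univ [Nontrivial X] (hΦ : IsLinear Φ) :
    ∃ B : ℝ, ∀ s ≤ B, refinedLyapunov Φ 0 s ≠ univ := by
  obtain ⟨C, hC0, hC⟩ := hΦ.exists_bound_Icc (-1) 0
  obtain ⟨x, hx⟩ := exists_ne (0 : X)
  have hn : ∀ n : ℕ, ‖x‖ ≤ C ^ n * ‖Φ n x‖ := by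
    intro n
    induction n with
    | zero => simp
    | succ n ih =>
      have h1 := hC (-1) ⟨le_rfl, by norm_num⟩ (Φ ((n + 1 : ℕ) : ℝ) x)
      rw [← Φ.map_add, show (-1 : ℝ) + ((n + 1 : ℕ) : ℝ) = n by push_cast; ring] at h1
      calc ‖x‖ ≤ C ^ n * ‖Φ n x‖ := ih
        _ ≤ C ^ n * (C * ‖Φ ((n + 1 : ℕ) : ℝ) x‖) := by gcongr
        _ = _ := by ring
  -- For `s ≤ -log C` the weight gives `exp (-s n) ≥ C ^ n`, so the weighted norm at integer times
  -- stays at least `‖x‖`.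
  refine ⟨-Real.log C, fun s hs huniv => ?_⟩
  have hxm : x ∈ refinedLyapunov Φ 0 s := huniv ▸ mem_univ x
  rw [mem_refinedLyapunov_iff] at hxm
  have hlim := (hxm.comp tendsto_natCast_atTop_atTop).eventually_lt_const (norm_pos_iff.2 hx)
  obtain ⟨n, hlt⟩ := hlim.exists
  refine absurd hlt (not_lt.2 ((hn n).trans ?_))
  simp only [Function.comp_apply, pow_zero, mul_one, ← Real.exp_neg]
  gcongr
  rw [← Real.exp_log hC0, ← Real.exp_nat_mul]
  gcongr
  nlinarith [Nat.cast_nonneg (α := ℝ) n]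

/-- Rescaling the exponents by a positive factor other than `1` changes the Lyapunov spaces. -/
theorem IsStable.rescaling_le_one [Nontrivial X] (hΦ : IsStable Φ) {q : ℝ}
    (hq : ∀ s, refinedLyapunov Φ 0 (q * s) = refinedLyapunov Φ 0 s) : q ≤ 1 := by
  by_contra! hlt
  obtain ⟨s, hs0, hs⟩ := hΦ.exists_refinedLyapunov_eq_univ
  obtain ⟨B, hB⟩ := hΦ.linear.exists_refinedLyapunov_ne_univ
  have hpow : ∀ n : ℕ, refinedLyapunov Φ 0 (q ^ n * s) = univ := by
    intro n
    induction n with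
    | zero => simpa using hs
    | succ n ih => rw [pow_succ', mul_assoc, hq, ih]
  -- As `s < 0`, multiplying by large powers of `q > 1` pushes the exponent below `B`.
  obtain ⟨n, hn⟩ := ((tendsto_pow_atTop_atTop_of_one_lt hlt).eventually_ge_atTop (B / s)).exists
  exact hB _ ((div_le_iff_of_neg hs0).1 hn) (hpow n)

/-- Both ratios `β / α` and `α / β` preserve the spaces, so neither exceeds `1`. -/
theorem IsStable.rescaling_unique [Nontrivial X] (hΦ : IsStable Φ) {α β : ℝ} (hα : 0 < α)
    (hβ : 0 < β) (hαβ : ∀ s, refinedLyapunov Φ 0 (β * s) = refinedLyapunov Φ 0 (α * s)) :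
    β = α := by
  refine le_antisymm ((div_le_one hα).1 (hΦ.rescaling_le_one fun s => ?_))
    ((div_le_one hβ).1 (hΦ.rescaling_le_one fun s => ?_))
  · rw [div_mul_eq_mul_div, mul_div_assoc, hαβ, mul_div_cancel₀ _ hα.ne']
  · rw [div_mul_eq_mul_div, mul_div_assoc, ← hαβ, mul_div_cancel₀ _ hβ.ne']

end Lyapunov

end LipFlow

/-- The last conjunct says that for every `x ≠ 0` the time reparametrization `τ_x` exists, is
unique, and satisfies `sup_{t ≥ 0} |τ_x t - α t| < ∞`. -/
theorem theorem3p7 {X : Type*} [NormedAddCommGroup X] [NormedSpace ℝ X] [FiniteDimensional ℝ X]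
    [Nontrivial X] (Φ Ψ : Flow ℝ X) (hΦ : LipFlow.IsStable Φ) (hΨ : LipFlow.IsStable Ψ)
    (h : X ≃ₜ X) (hLip : LipFlow.IsBiLipschitzNearZero h) (hrel : LipFlow.IsRelated Φ Ψ h) :
    ∃ α : ℝ, 0 < α ∧
      (∀ (m : ℕ) (s : ℝ),
        h '' LipFlow.refinedLyapunov Φ m (α * s) = LipFlow.refinedLyapunov Ψ m s) ∧
      (∀ β : ℝ, 0 < β →
        (∀ (m : ℕ) (s : ℝ),
          h '' LipFlow.refinedLyapunov Φ m (β * s) = LipFlow.refinedLyapunov Ψ m s) →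
        β = α) ∧
      (∀ x : X, x ≠ 0 →
        (∃! τ : ℝ → ℝ, LipFlow.IsTimeReparam Φ Ψ h x τ) ∧
        ∀ τ : ℝ → ℝ, LipFlow.IsTimeReparam Φ Ψ h x τ →
          BddAbove ((fun t : ℝ => |τ t - α * t|) '' Set.Ici 0)) := by
  obtain ⟨α, hα, hspeed⟩ := LipFlow.exists_speed hΦ hΨ hLip hrel
  have himage : ∀ (m : ℕ) (s : ℝ),
      h '' LipFlow.refinedLyapunov Φ m (α * s) = LipFlow.refinedLyapunov Ψ m s := by
    intro m s
    have hmem : ∀ x, h x ∈ LipFlow.refinedLyapunov Ψ m s ↔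
        x ∈ LipFlow.refinedLyapunov Φ m (α * s) := by
      intro x
      by_cases hx : x = 0
      · subst hx
        rw [hLip.1]
        exact iff_of_true (hΨ.linear.zero_mem_refinedLyapunov m s)
          (hΦ.linear.zero_mem_refinedLyapunov m _)
      · obtain ⟨τ, hτ⟩ := hrel.exists_isTimeReparam hΦ hΨ hLip.1 hx
        obtain ⟨D, hD⟩ := hspeed x τ hx hτ
        exact hτ.map_mem_refinedLyapunov_iff hΦ hΨ hLip hα hD m s
    have hpre : h ⁻¹' LipFlow.refinedLyapunov Ψ m s = LipFlow.refinedLyapunov Φ m (α * s) :=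
      Set.ext hmem
    rw [← hpre, h.image_preimage]
  refine ⟨α, hα, himage, fun β hβ hβimage => ?_, fun x hx => ⟨?_, fun τ hτ => ?_⟩⟩
  -- The spaces with `m = 0` already determine `α`.
  · exact hΦ.rescaling_unique hα hβ fun s =>
      h.injective.image_injective ((hβimage 0 s).trans (himage 0 s).symm)
  · obtain ⟨τ, hτ⟩ := hrel.exists_isTimeReparam hΦ hΨ hLip.1 hx
    exact ⟨τ, hτ, fun τ' hτ' => hτ'.unique hΨ hLip.1 hx hτ⟩
  · obtain ⟨D, hD⟩ := hspeed x τ hx hτ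
    refine ⟨D, ?_⟩
    rintro _ ⟨t, ht, rfl⟩
    exact hD t ht
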